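/- Fix an integer $\kappa\ge 1$ and a sequence $p=p(n)\in[0,1]$, $n\in\mathbb N$. Let $\mathbf Y_\kappa(n,p)$ be the Linial–Meshulam–Wallach random $\kappa$-complex: the random simplicial complex obtained by adding to the full $(\kappa-1)$-skeleton of the $(n-1)$-dimensional simplex with $n$ vertices each $\kappa$-face (set of $\kappa+1$ vertices) independently with probability $p$. A $(\kappa-1)$-face of $\mathbf Y_\kappa(n,p)$ is called isolated if it is not contained in any $\kappa$-face of $\mathbf Y_\kappa(n,p)$. Let $I$ be the number of isolated $(\kappa-1)$-faces in $\mathbf Y_\kappa(n,p)$, let $F:=(I-\mathbb E I)/\sqrt{\operatorname{Var}(I)}$, let $N$ be a standard Gaussian random variable, and let $d_K(X,Y):=\sup_{z\in\mathbb R}|\mathbb P(X\le z)-\mathbb P(Y\le z)|$ denote the Kolmogorov distance. If $np=\mathcal O(1)$ and $n^{\kappa+1}p\to\infty$ as $n\to\infty$, then $$d_K(F,N)=\mathcal O\big(n^{-(\kappa+1)/2}\,p^{-1/2}\big)\qquad\text{as } n\to\infty.$$ -/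

import Mathlib

open MeasureTheory ProbabilityTheory Filter Topology Asymptotics

/-- The Kolmogorov distance `sup_z |P(X ≤ z) - Q(Y ≤ z)|` between (the laws of) the real random
variables `X` on `(Ω, P)` and `Y` on `(Ω', Q)`. -/
noncomputable def kolmogorovDist {Ω Ω' : Type*} [MeasurableSpace Ω] [MeasurableSpace Ω']
    (X : Ω → ℝ) (P : Measure Ω) (Y : Ω' → ℝ) (Q : Measure Ω') : ℝ :=
  ⨆ z : ℝ, |P.real {ω | X ω ≤ z} - Q.real {ω | Y ω ≤ z}|

/-- The normalization `(X - E X) / √(Var X)` of a real random variable `X` on `(Ω, P)`. -/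
noncomputable def normalized {Ω : Type*} [MeasurableSpace Ω] (X : Ω → ℝ) (P : Measure Ω) :
    Ω → ℝ :=
  fun ω => (X ω - ∫ ω', X ω' ∂P) / √(variance X P)

namespace RandomComplex

/-- The `k`-faces of the `(n-1)`-dimensional simplex with `n` vertices, as `(k+1)`-element sets of
vertices. -/
def simplexFaces (k n : ℕ) : Set (Finset (Fin n)) :=
  {t | t.card = k + 1}

/-- The simplicial complex obtained by adding the `κ`-faces that belong to `A` to the full
`(κ-1)`-skeleton of the `(n-1)`-dimensional simplex (all nonempty sets of at most `κ` vertices). -/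
def complexOf (κ n : ℕ) (A : Set (Finset (Fin n))) : PreAbstractSimplicialComplex (Fin n) where
  faces := {s | s.Nonempty ∧ s.card ≤ κ} ∪ (A ∩ simplexFaces κ n)
  isRelLowerSet_faces := by
    rintro s (⟨hs, hc⟩ | ⟨hA, hc⟩)
    · exact ⟨hs, fun t hts ht => Or.inl ⟨ht, (Finset.card_le_card hts).trans hc⟩⟩
    · have hc' : s.card = κ + 1 := hc
      refine ⟨Finset.card_pos.mp (by omega), fun t hts ht => ?_⟩
      by_cases h : t.card ≤ κ
      · exact Or.inl ⟨ht, h⟩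
      · have hst : t = s := Finset.eq_of_subset_of_card_le hts (by omega)
        exact Or.inr (hst ▸ ⟨hA, hc⟩)

/-- The probability measure under which every `κ`-face of the `(n-1)`-simplex is selected
independently with probability `p` (and nothing else is selected).
The Linial–Meshulam–Wallach random `κ`-complex `Y_κ(n, p)` is the random complex `complexOf κ n`
on this probability space. -/
noncomputable def faceMeasure (κ n : ℕ) (p : unitInterval) : Measure (Set (Finset (Fin n))) :=
  setBernoulli (simplexFaces κ n) p

/-- `s` is an isolated `(κ-1)`-face of `K`: a face with `κ` vertices that is not contained in
any `κ`-face of `K`. -/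
def IsIsolatedFace {n : ℕ} (κ : ℕ) (K : PreAbstractSimplicialComplex (Fin n))
    (s : Finset (Fin n)) : Prop :=
  s ∈ K ∧ s.card = κ ∧ ∀ t ∈ K, t.card = κ + 1 → ¬ s ⊆ t

/-- The number `I` of isolated `(κ-1)`-faces in the random `κ`-complex, as a random variable on the
probability space of `faceMeasure κ n p`. -/
noncomputable def numIsolatedFaces (κ n : ℕ) : Set (Finset (Fin n)) → ℝ :=
  fun A => ({s | IsIsolatedFace κ (complexOf κ n A) s}.ncard : ℝ)

end RandomComplex

/-! ### The Stein equation of the standard normal law. -/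

namespace SteinSolution

/-! The argument is Stein's method combined with integration by parts on the discrete cube, where
each `κ`-face is an independent Bernoulli coordinate. Let `D j` be the difference in coordinate `j`.
A Clark–Ocone formula writes `F - E F` as a sum of centered coordinates times coefficients `b j`
that ignore coordinate `j` and inherit the bounds on the differences of `F`. Hence `E[G (F - E F)]`
equals the expectation of `∑ p j (1 - p j) b j (D j G)`.

With `W = (F - E F) / σ`, `G = f(W)` and `f` the Stein solution for a half-line, replacing `D j
f(W)` by `f'(W) D j W` leaves two errors (`abs_map_stein_le`). One is the fluctuation of `T = ∑ p j
(1 - p j) b j (D j F)` about its mean `σ ^ 2`; a Poincaré inequality controls it through second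
differences. The other is the Taylor remainder. Since `f'` jumps, it is not bounded by `(D j W) ^
2`; instead `abs_stein_sub_le` bounds it by `D j W * D j g(W)` with `g` monotone and bounded. A
second integration by parts moves the difference off `g`, so only the second moment of `∑ centered j
* D j F` matters and no smoothing of the half-line is needed.

For isolated faces, first differences are at most `κ + 1`, and second differences vanish unless two
`κ`-faces share a `(κ-1)`-face, so their weighted row sums are of order `n p`. Both errors are then
of order `√S / Var` with `S = n.choose (κ + 1) * p`. Projection to linear functions gives a variance
of order at least `S` when `n p` is bounded (`le_variance_numIsolatedFaces`), and the rate is `S ^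
(-1/2)`. -/

lemma integrable_exp_neg_sq_half : Integrable fun x : ℝ => Real.exp (-x ^ 2 / 2) := by
  convert! integrable_exp_neg_mul_sq (b := 1 / 2) (by norm_num) using 2
  ring_nf

lemma integrable_mul_exp_neg_sq_half : Integrable fun x : ℝ => x * Real.exp (-x ^ 2 / 2) := by
  convert! integrable_mul_exp_neg_mul_sq (b := 1 / 2) (by norm_num) using 2
  ring_nf

lemma exp_tilt_eq (w t : ℝ) :
    Real.exp (w * t - t ^ 2 / 2) = Real.exp (w ^ 2 / 2) * Real.exp (-(t - w) ^ 2 / 2) := by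
  rw [← Real.exp_add]; ring_nf

lemma integrable_exp_tilt (w : ℝ) : Integrable fun t : ℝ => Real.exp (w * t - t ^ 2 / 2) := by
  simp_rw [exp_tilt_eq]
  exact (integrable_exp_neg_sq_half.comp_sub_right w).const_mul _

lemma integrable_mul_exp_tilt (w : ℝ) :
    Integrable fun t : ℝ => t * Real.exp (w * t - t ^ 2 / 2) := by
  have : (fun t : ℝ => t * Real.exp (w * t - t ^ 2 / 2)) = fun t => Real.exp (w ^ 2 / 2) *
      ((t - w) * Real.exp (-(t - w) ^ 2 / 2) + w * Real.exp (-(t - w) ^ 2 / 2)) := by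
    funext t; rw [exp_tilt_eq]; ring
  rw [this]
  exact ((integrable_mul_exp_neg_sq_half.comp_sub_right w).add
    ((integrable_exp_neg_sq_half.comp_sub_right w).const_mul w)).const_mul _

/-- The Mills ratio of the standard normal distribution, reflected at the origin. -/
noncomputable def mills (w : ℝ) : ℝ := ∫ t in Set.Ioi (0 : ℝ), Real.exp (w * t - t ^ 2 / 2)

lemma mul_mills_add_one (w : ℝ) :
    w * mills w + 1 = ∫ t in Set.Ioi (0 : ℝ), t * Real.exp (w * t - t ^ 2 / 2) := by
  have hd : ∀ t ∈ Set.Ici (0 : ℝ), HasDerivAt (fun t => -Real.exp (w * t - t ^ 2 / 2))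
      (t * Real.exp (w * t - t ^ 2 / 2) - w * Real.exp (w * t - t ^ 2 / 2)) t := by
    intro t _
    have := (((hasDerivAt_id t).const_mul w).sub
      (((hasDerivAt_id t).pow 2).div_const 2)).exp.neg
    convert! this using 1
    simp
    ring
  have hint : IntegrableOn (fun t => t * Real.exp (w * t - t ^ 2 / 2)
      - w * Real.exp (w * t - t ^ 2 / 2)) (Set.Ioi 0) :=
    ((integrable_mul_exp_tilt w).sub ((integrable_exp_tilt w).const_mul w)).integrableOn
  have hlim : Tendsto (fun t : ℝ => -Real.exp (w * t - t ^ 2 / 2)) atTop (𝓝 0) := by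
    rw [← neg_zero]
    refine Tendsto.neg (Real.tendsto_exp_atBot.comp ?_)
    have h1 : (fun t : ℝ => w * t - t ^ 2 / 2) = fun t => t * (w - t / 2) := by
      funext t; ring
    rw [h1]
    refine tendsto_id.atTop_mul_atBot₀ ?_
    refine tendsto_atBot_add_const_left _ w ?_
    exact tendsto_neg_atTop_atBot.comp (tendsto_id.atTop_div_const (by norm_num))
  have h := integral_Ioi_of_hasDerivAt_of_tendsto' hd hint hlim
  rw [integral_sub (integrable_mul_exp_tilt w).integrableOn
    ((integrable_exp_tilt w).const_mul w).integrableOn, integral_const_mul] at h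
  simp only [mul_zero, ne_eq, OfNat.ofNat_ne_zero, not_false_eq_true, zero_pow, zero_div, sub_zero,
    Real.exp_zero, sub_neg_eq_add, zero_add] at h
  unfold mills
  linarith

lemma neg_one_le_mul_mills (w : ℝ) : -1 ≤ w * mills w := by
  have := mul_mills_add_one w
  have h2 : 0 ≤ ∫ t in Set.Ioi (0 : ℝ), t * Real.exp (w * t - t ^ 2 / 2) :=
    setIntegral_nonneg measurableSet_Ioi fun t ht => mul_nonneg (le_of_lt ht) (Real.exp_pos _).le
  linarith

/-- By `mul_mills_add_one` this is, up to a constant, an integral over `t > 0` whose integrand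
increases with `w`. -/
lemma monotone_mul_mills : Monotone fun w => w * mills w := by
  intro v w hvw
  have h1 := mul_mills_add_one v
  have h2 := mul_mills_add_one w
  have h3 : (∫ t in Set.Ioi (0 : ℝ), t * Real.exp (v * t - t ^ 2 / 2))
      ≤ ∫ t in Set.Ioi (0 : ℝ), t * Real.exp (w * t - t ^ 2 / 2) := by
    refine setIntegral_mono_on (integrable_mul_exp_tilt v).integrableOn
      (integrable_mul_exp_tilt w).integrableOn measurableSet_Ioi fun t ht => ?_
    have ht0 : (0 : ℝ) ≤ t := le_of_lt ht
    gcongr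
  simp only
  linarith

lemma mills_eq (w : ℝ) :
    mills w = Real.exp (w ^ 2 / 2) * ∫ x in Set.Iic w, Real.exp (-x ^ 2 / 2) := by
  unfold mills
  simp_rw [exp_tilt_eq]
  rw [integral_const_mul]
  congr 1
  have h := integral_comp_neg_Ioi (0 : ℝ) (fun s => Real.exp (-(s + w) ^ 2 / 2))
  have h2 : (fun x : ℝ => Real.exp (-(-x + w) ^ 2 / 2)) = fun t => Real.exp (-(t - w) ^ 2 / 2) := by
    funext t; ring_nf
  rw [h2] at h
  rw [h, neg_zero]
  rw [← (measurePreserving_add_right volume w).setIntegral_preimage_emb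
    (measurableEmbedding_addRight w) (fun x => Real.exp (-x ^ 2 / 2)) (Set.Iic w)]
  simp

lemma hasDerivAt_mills (w : ℝ) : HasDerivAt mills (w * mills w + 1) w := by
  have hG : HasDerivAt (fun w => ∫ x in Set.Iic w, Real.exp (-x ^ 2 / 2))
      (Real.exp (-w ^ 2 / 2)) w := by
    have hc : Continuous fun x : ℝ => Real.exp (-x ^ 2 / 2) := by fun_prop
    have h1 := (intervalIntegral.integral_hasDerivAt_right (hc.intervalIntegrable 0 w)
      (hc.stronglyMeasurableAtFilter _ _) hc.continuousAt).add_const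
        (∫ x in Set.Iic (0 : ℝ), Real.exp (-x ^ 2 / 2))
    refine h1.congr_of_eventuallyEq (Eventually.of_forall fun u => ?_)
    have := intervalIntegral.integral_Iic_sub_Iic (a := 0) (b := u)
      integrable_exp_neg_sq_half.integrableOn integrable_exp_neg_sq_half.integrableOn
    simp only
    rw [← this]; ring
  have hE : HasDerivAt (fun w : ℝ => Real.exp (w ^ 2 / 2)) (Real.exp (w ^ 2 / 2) * w) w := by
    convert! (((hasDerivAt_id w).pow 2).div_const 2).exp using 1
    simp
  have h := hE.mul hG
  have heq : mills = (fun w : ℝ => Real.exp (w ^ 2 / 2)) *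
      fun w => ∫ x in Set.Iic w, Real.exp (-x ^ 2 / 2) := funext mills_eq
  rw [← heq] at h
  convert! h using 1
  rw [mills_eq w, ← Real.exp_add, show w ^ 2 / 2 + -w ^ 2 / 2 = 0 by ring, Real.exp_zero]
  ring

lemma continuous_mills : Continuous mills :=
  continuous_iff_continuousAt.2 fun w => (hasDerivAt_mills w).continuousAt

lemma gaussianReal_real_Iic (z : ℝ) : (gaussianReal 0 1).real (Set.Iic z)
    = (√(2 * Real.pi))⁻¹ * ∫ x in Set.Iic z, Real.exp (-x ^ 2 / 2) := by
  rw [measureReal_def, gaussianReal_apply_eq_integral _ one_ne_zero, ENNReal.toReal_ofReal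
    (setIntegral_nonneg measurableSet_Iic fun x _ => gaussianPDFReal_nonneg _ _ _),
    ← integral_const_mul]
  simp [gaussianPDFReal]

lemma one_sub_gaussianReal_real_Iic (z : ℝ) : 1 - (gaussianReal 0 1).real (Set.Iic z)
    = (gaussianReal 0 1).real (Set.Iic (-z)) := by
  have h1 : (gaussianReal 0 1).map (fun x => -x) = gaussianReal 0 1 := by
    rw [gaussianReal_map_neg, neg_zero]
  rw [← probReal_compl_eq_one_sub measurableSet_Iic, ← h1,
    map_measureReal_apply measurable_neg measurableSet_Iic, h1, Set.compl_Iic]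
  have : (fun x : ℝ => -x) ⁻¹' Set.Iic (-z) = Set.Ici z := by ext; simp
  rw [this]
  have := nullSingletonClass_gaussianReal (μ := 0) (v := 1) one_ne_zero
  exact measureReal_congr Ioi_ae_eq_Ici

/-- The mass of the standard normal distribution below `z`. -/
noncomputable def gaussCDF (z : ℝ) : ℝ := (gaussianReal 0 1).real (Set.Iic z)

/-- This makes the two branches of `stein z` agree at `z`, hence its continuity. -/
lemma gaussCDF_balance (z : ℝ) : (1 - gaussCDF z) * mills z = gaussCDF z * mills (-z) := by
  unfold gaussCDF
  rw [one_sub_gaussianReal_real_Iic, mills_eq, mills_eq, gaussianReal_real_Iic,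
    gaussianReal_real_Iic, neg_sq]
  ring

lemma gaussCDF_nonneg (z : ℝ) : 0 ≤ gaussCDF z := measureReal_nonneg

lemma gaussCDF_le_one (z : ℝ) : gaussCDF z ≤ 1 := measureReal_le_one

/-- The bounded solution of the Stein equation `f' x = x f x + 1_{x ≤ z} - Φ z`. -/
noncomputable def stein (z x : ℝ) : ℝ :=
  if x ≤ z then (1 - gaussCDF z) * mills x else gaussCDF z * mills (-x)

/-- The derivative of the solution of the Stein equation. -/
noncomputable def steinDeriv (z x : ℝ) : ℝ :=
  x * stein z x + (if x ≤ z then 1 else 0) - gaussCDF z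

/-- A monotone function controlling the oscillation of `steinDeriv z`. -/
noncomputable def steinMajorant (z x : ℝ) : ℝ := x * stein z x + (if x ≤ z then 0 else 1)

lemma continuous_stein (z : ℝ) : Continuous (stein z) := by
  refine Continuous.if_le (continuous_const.mul continuous_mills)
    (continuous_const.mul (continuous_mills.comp continuous_neg)) continuous_id continuous_const ?_
  rintro x rfl
  exact gaussCDF_balance _

lemma hasDerivAt_stein {z x : ℝ} (hx : x ≠ z) : HasDerivAt (stein z) (steinDeriv z x) x := by
  rcases lt_or_gt_of_ne hx with h | h
  · have h1 := (hasDerivAt_mills x).const_mul (1 - gaussCDF z)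
    have h2 : stein z =ᶠ[𝓝 x] fun x => (1 - gaussCDF z) * mills x := by
      filter_upwards [eventually_lt_nhds h] with y hy
      simp [stein, hy.le]
    refine (h1.congr_of_eventuallyEq h2).congr_deriv ?_
    simp only [steinDeriv, stein, h.le, if_true]; ring
  · have h1 := ((hasDerivAt_mills (-x)).comp x (hasDerivAt_neg x)).const_mul (gaussCDF z)
    have h2 : stein z =ᶠ[𝓝 x] fun x => gaussCDF z * mills (-x) := by
      filter_upwards [eventually_gt_nhds h] with y hy
      simp [stein, not_le.2 hy]
    refine (h1.congr_of_eventuallyEq h2).congr_deriv ?_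
    simp only [steinDeriv, stein, not_le.2 h, if_false]; ring

lemma monotone_mul_stein (z : ℝ) : Monotone fun x => x * stein z x := by
  have hc := gaussCDF_nonneg z
  have hc' := sub_nonneg.2 (gaussCDF_le_one z)
  have hL : ∀ x y, x ≤ y → (1 - gaussCDF z) * (x * mills x) ≤ (1 - gaussCDF z) * (y * mills y) :=
    fun x y h => mul_le_mul_of_nonneg_left (monotone_mul_mills h) hc'
  have hR : ∀ x y, x ≤ y →
      gaussCDF z * (x * mills (-x)) ≤ gaussCDF z * (y * mills (-y)) := by
    intro x y h
    have := monotone_mul_mills (neg_le_neg h)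
    simp only at this
    exact mul_le_mul_of_nonneg_left (by linarith) hc
  have hz := gaussCDF_balance z
  intro x y hxy
  simp only [stein]
  split_ifs with h1 h2 h2
  · have := hL x y hxy; linarith
  · have e1 := hL x z h1
    have e2 := hR z y (not_le.1 h2).le
    have e3 : (1 - gaussCDF z) * (z * mills z) = gaussCDF z * (z * mills (-z)) := by
      linear_combination z * hz
    linarith
  · exact absurd (hxy.trans h2) h1
  · have := hR x y hxy; linarith

/-- On each side of `z` one bound comes from `neg_one_le_mul_mills`. The other comes from
monotonicity, by comparison with the value at `z`, rewritten by the formula of the opposite branch.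
-/
lemma abs_mul_stein_le (z x : ℝ) : |x * stein z x| ≤ 1 := by
  have hc := gaussCDF_nonneg z
  have hc' := gaussCDF_le_one z
  have h1 := neg_one_le_mul_mills
  have hz : z * stein z z = gaussCDF z * (z * mills (-z)) := by
    simp only [stein, le_refl, if_true]; linear_combination z * gaussCDF_balance z
  have hz' : z * stein z z = (1 - gaussCDF z) * (z * mills z) := by
    simp only [stein, le_refl, if_true]; ring
  have hmono := monotone_mul_stein z
  rw [abs_le]
  by_cases hx : x ≤ z
  · have e1 : x * stein z x = (1 - gaussCDF z) * (x * mills x) := by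
      simp only [stein, hx, if_true]; ring
    have e2 := hmono hx
    simp only at e2
    constructor
    · rw [e1]; nlinarith [h1 x]
    · nlinarith [h1 (-z)]
  · have e1 : x * stein z x = gaussCDF z * (x * mills (-x)) := by
      simp only [stein, hx, if_false]; ring
    have e2 := hmono (not_le.1 hx).le
    simp only at e2
    constructor
    · nlinarith [h1 z]
    · rw [e1]; nlinarith [h1 (-x)]

lemma abs_steinDeriv_le (z x : ℝ) : |steinDeriv z x| ≤ 2 := by
  have h := abs_le.1 (abs_mul_stein_le z x)
  have hc := gaussCDF_nonneg z
  have hc' := gaussCDF_le_one z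
  rw [steinDeriv, abs_le]
  split_ifs <;> constructor <;> linarith

lemma abs_steinMajorant_le (z x : ℝ) : |steinMajorant z x| ≤ 2 := by
  have h := abs_le.1 (abs_mul_stein_le z x)
  rw [steinMajorant, abs_le]
  split_ifs <;> constructor <;> linarith

/-- `steinDeriv z` is a difference of two monotone functions up to a constant, and `steinMajorant z`
is their sum, so its increment dominates the oscillation, jump at `z` included. -/
lemma abs_steinDeriv_sub_le {z a b x y : ℝ} (hx : x ∈ Set.Icc a b) (hy : y ∈ Set.Icc a b) :
    |steinDeriv z x - steinDeriv z y| ≤ steinMajorant z b - steinMajorant z a := by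
  have h1 : ∀ {u v : ℝ}, u ≤ v → u * stein z u ≤ v * stein z v := fun h => monotone_mul_stein z h
  have h2 : ∀ {u v : ℝ}, u ≤ v →
      (if u ≤ z then (0 : ℝ) else 1) ≤ if v ≤ z then 0 else 1 := by
    intro u v h
    split_ifs with p q
    · exact le_rfl
    · exact zero_le_one
    · exact absurd (h.trans (by assumption)) p
    · exact le_rfl
  have h3 : ∀ u : ℝ, (if u ≤ z then (1 : ℝ) else 0) = 1 - if u ≤ z then (0 : ℝ) else 1 := by
    intro u; split_ifs <;> norm_num
  have := h1 hx.1
  have := h1 hx.2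
  have := h1 hy.1
  have := h1 hy.2
  have := h2 hx.1
  have := h2 hx.2
  have := h2 hy.1
  have := h2 hy.2
  simp only [steinDeriv, steinMajorant, h3]
  rw [abs_le]
  constructor <;> linarith

lemma intervalIntegrable_steinDeriv (z a b : ℝ) :
    IntervalIntegrable (steinDeriv z) volume a b := by
  have h : Antitone fun x : ℝ => if x ≤ z then (1 : ℝ) else 0 := by
    intro u v h
    simp only
    split_ifs with p q
    · exact le_rfl
    · exact absurd (h.trans p) q
    · exact zero_le_one
    · exact le_rfl
  exact ((monotone_mul_stein z).intervalIntegrable.add h.intervalIntegrable).sub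
    intervalIntegrable_const

lemma abs_stein_sub_le_aux (z : ℝ) {a b c : ℝ} (hab : a ≤ b) (hc : c ∈ Set.Icc a b) :
    |stein z b - stein z a - steinDeriv z c * (b - a)|
      ≤ (b - a) * (steinMajorant z b - steinMajorant z a) := by
  -- The solution has a kink at `z`; it is continuous, so one exceptional point is harmless.
  have hFTC := MeasureTheory.integral_eq_of_hasDerivAt_off_countable (a := a) (b := b)
    (stein z) (steinDeriv z) (Set.countable_singleton z) (continuous_stein z).continuousOn
    (fun x hx => hasDerivAt_stein hx.2) (intervalIntegrable_steinDeriv z a b)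
  have h1 : stein z b - stein z a - steinDeriv z c * (b - a)
      = ∫ x in a..b, (steinDeriv z x - steinDeriv z c) := by
    rw [intervalIntegral.integral_sub (intervalIntegrable_steinDeriv z a b)
      intervalIntegrable_const, hFTC, intervalIntegral.integral_const, smul_eq_mul]
    ring
  rw [h1, ← Real.norm_eq_abs, mul_comm, ← abs_of_nonneg (sub_nonneg.2 hab)]
  refine intervalIntegral.norm_integral_le_of_norm_le_const fun x hx => ?_
  rw [Set.uIoc_of_le hab] at hx
  exact abs_steinDeriv_sub_le (Set.Ioc_subset_Icc_self hx) hc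

lemma abs_stein_sub_le (z x y : ℝ) :
    |stein z y - stein z x - steinDeriv z x * (y - x)|
      ≤ (y - x) * (steinMajorant z y - steinMajorant z x) := by
  rcases le_total x y with h | h
  · exact abs_stein_sub_le_aux z h (Set.left_mem_Icc.2 h)
  · have := abs_stein_sub_le_aux z h (Set.right_mem_Icc.2 h)
    rw [← abs_neg]
    convert! this using 1
    · congr 1; ring
    · ring

end SteinSolution

/-! ### Difference calculus on the Bernoulli cube. -/

namespace BernoulliCube

variable {ι : Type*}

/-- The discrete derivative of `F` in the direction of the coordinate `j`. -/
def discDeriv (j : ι) (F : Set ι → ℝ) : Set ι → ℝ :=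
  fun A => F (insert j A) - F (A \ {j})

/-- The average of `F` over the coordinate `j`, which is present with probability `p j`. -/
def avgAt (p : ι → ℝ) (j : ι) (F : Set ι → ℝ) : Set ι → ℝ :=
  fun A => p j * F (insert j A) + (1 - p j) * F (A \ {j})

open Classical in
/-- The centered indicator of the presence of the coordinate `j`. -/
noncomputable def centered (p : ι → ℝ) (j : ι) : Set ι → ℝ :=
  fun A => (if j ∈ A then 1 else 0) - p j

lemma insert_sdiff_comm {i j : ι} (h : i ≠ j) (A : Set ι) :
    insert i (A \ {j}) = insert i A \ {j} := by
  ext x; simp only [Set.mem_insert_iff, Set.mem_sdiff, Set.mem_singleton_iff]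
  constructor
  · rintro (rfl | ⟨h1, h2⟩)
    · exact ⟨Or.inl rfl, h⟩
    · exact ⟨Or.inr h1, h2⟩
  · rintro ⟨rfl | h1, h2⟩
    · exact Or.inl rfl
    · exact Or.inr ⟨h1, h2⟩

lemma eq_avgAt_add (p : ι → ℝ) (j : ι) (F : Set ι → ℝ) (A : Set ι) :
    F A = avgAt p j F A + centered p j A * discDeriv j F A := by
  by_cases h : j ∈ A
  · simp only [avgAt, centered, discDeriv, Set.insert_eq_of_mem h, if_pos h]; ring
  · simp only [avgAt, centered, discDeriv, Set.sdiff_singleton_eq_self h, if_neg h]; ring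

lemma discDeriv_avgAt_self (p : ι → ℝ) (j : ι) (F : Set ι → ℝ) : discDeriv j (avgAt p j F) = 0 := by
  funext A
  simp [discDeriv, avgAt]

lemma discDeriv_discDeriv_self (j : ι) (F : Set ι → ℝ) : discDeriv j (discDeriv j F) = 0 := by
  funext A
  simp [discDeriv]

lemma discDeriv_avgAt_comm (p : ι → ℝ) {i j : ι} (h : i ≠ j) (F : Set ι → ℝ) :
    discDeriv i (avgAt p j F) = avgAt p j (discDeriv i F) := by
  funext A
  simp only [discDeriv, avgAt, Set.insert_comm i j, insert_sdiff_comm h, insert_sdiff_comm h.symm,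
    Set.sdiff_sdiff_comm (u := {i})]
  ring

lemma abs_avgAt_le {p : ι → ℝ} {j : ι} (h0 : 0 ≤ p j) (h1 : p j ≤ 1) {F : Set ι → ℝ} {a : ℝ}
    (hF : ∀ A, |F A| ≤ a) (A : Set ι) : |avgAt p j F A| ≤ a := by
  have h2 := abs_le.1 (hF (insert j A))
  have h3 := abs_le.1 (hF (A \ {j}))
  unfold avgAt
  rw [abs_le]
  constructor <;> nlinarith

lemma eq_insert_and_sdiff_of_discDeriv_eq_zero {j : ι} {B : Set ι → ℝ} (hB : discDeriv j B = 0)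
    (A : Set ι) : B (insert j A) = B A ∧ B (A \ {j}) = B A := by
  have h := congrFun hB A
  simp only [discDeriv, Pi.zero_apply, sub_eq_zero] at h
  by_cases hj : j ∈ A
  · rw [Set.insert_eq_of_mem hj] at h ⊢; exact ⟨rfl, h.symm⟩
  · rw [Set.sdiff_singleton_eq_self hj] at h ⊢; exact ⟨h, rfl⟩

lemma eq_const_of_discDeriv_eq_zero [Finite ι] {G : Set ι → ℝ} (hG : ∀ j, discDeriv j G = 0)
    (A : Set ι) : G A = G ∅ := by
  induction A, A.toFinite using Set.Finite.induction_on with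
  | empty => rfl
  | insert _ _ ih => rw [(eq_insert_and_sdiff_of_discDeriv_eq_zero (hG _) _).1, ih]

/-- `E` is the expectation of functions of a random subset of `ι` that contains the elements `j`
independently with probabilities `p j`. -/
structure IsExpectation (p : ι → ℝ) (E : (Set ι → ℝ) →ₗ[ℝ] ℝ) : Prop where
  nonneg_prob : ∀ j, 0 ≤ p j
  prob_le_one : ∀ j, p j ≤ 1
  nonneg : ∀ F, (∀ A, 0 ≤ F A) → 0 ≤ E F
  map_one : E (fun _ => 1) = 1
  map_avgAt : ∀ j F, E (avgAt p j F) = E F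

namespace IsExpectation

variable {p : ι → ℝ} {E : (Set ι → ℝ) →ₗ[ℝ] ℝ} (hE : IsExpectation p E)
include hE

lemma map_const (c : ℝ) : E (fun _ => c) = c := by
  have : (fun _ : Set ι => c) = c • (fun _ => (1 : ℝ)) := by funext; simp
  rw [this, map_smul, hE.map_one, smul_eq_mul, mul_one]

lemma mono {F G : Set ι → ℝ} (h : ∀ A, F A ≤ G A) : E F ≤ E G := by
  have := hE.nonneg (G - F) (fun A => sub_nonneg.2 (h A))
  rw [map_sub] at this
  linarith

lemma abs_map_le (F : Set ι → ℝ) : |E F| ≤ E (fun A => |F A|) := by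
  rw [abs_le]
  constructor
  · rw [← map_neg]; exact hE.mono fun A => neg_abs_le _
  · exact hE.mono fun A => le_abs_self _

lemma map_abs_le_sqrt (F : Set ι → ℝ) : E (fun A => |F A|) ≤ √(E (fun A => F A ^ 2)) := by
  set c := E (fun A => |F A|)
  have h1 := hE.nonneg (fun A => (|F A| - c) ^ 2) (fun A => sq_nonneg _)
  have h2 : (fun A => (|F A| - c) ^ 2)
      = (fun A => F A ^ 2) - (2 * c) • (fun A => |F A|) + (fun _ => c ^ 2) := by
    funext A
    simp only [Pi.add_apply, Pi.sub_apply, Pi.smul_apply, smul_eq_mul]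
    rw [← sq_abs (F A)]; ring
  rw [h2, map_add, map_sub, map_smul, hE.map_const, smul_eq_mul] at h1
  apply Real.le_sqrt_of_sq_le
  have : E (fun A => |F A|) = c := rfl
  rw [this] at h1
  nlinarith

/-- Integration by parts in one coordinate: averaging over `j` weights the two values of `G` by `p j
* (1 - p j)` with opposite signs. -/
lemma map_centered_mul (j : ι) {B : Set ι → ℝ} (hB : discDeriv j B = 0) (G : Set ι → ℝ) :
    E (fun A => centered p j A * B A * G A)
      = p j * (1 - p j) * E (fun A => B A * discDeriv j G A) := by
  rw [← hE.map_avgAt j, ← smul_eq_mul (p j * _), ← map_smul]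
  congr 1
  funext A
  obtain ⟨h1, h2⟩ := eq_insert_and_sdiff_of_discDeriv_eq_zero hB A
  simp only [avgAt, centered, Pi.smul_apply, smul_eq_mul, h1, h2, discDeriv, Set.mem_insert_iff,
    true_or, if_true, Set.mem_sdiff, Set.mem_singleton_iff, not_true, and_false, if_false]
  ring

end IsExpectation

lemma map_fun_sum {α : Type*} (E : (Set ι → ℝ) →ₗ[ℝ] ℝ) (s : Finset α) (f : α → Set ι → ℝ) :
    E (fun A => ∑ j ∈ s, f j A) = ∑ j ∈ s, E (f j) := by
  rw [← map_sum]; congr 1; funext A; simp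

lemma map_fun_mul (E : (Set ι → ℝ) →ₗ[ℝ] ℝ) (c : ℝ) (f : Set ι → ℝ) :
    E (fun A => c * f A) = c * E f := by
  rw [← smul_eq_mul, ← map_smul]; rfl

lemma map_fun_sub (E : (Set ι → ℝ) →ₗ[ℝ] ℝ) (f g : Set ι → ℝ) :
    E (fun A => f A - g A) = E f - E g := by
  rw [← map_sub]; rfl

lemma map_fun_add (E : (Set ι → ℝ) →ₗ[ℝ] ℝ) (f g : Set ι → ℝ) :
    E (fun A => f A + g A) = E f + E g := by
  rw [← map_add]; rfl

/-- The coefficients of a partial Clark–Ocone decomposition inherit the bounds on the first and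
second differences of `F`. -/
lemma exists_partial_clarkOcone {p : ι → ℝ} (hp0 : ∀ j, 0 ≤ p j) (hp1 : ∀ j, p j ≤ 1)
    {a : ι → ℝ} {H : ι → ι → ℝ} {F : Set ι → ℝ}
    (ha : ∀ j A, |discDeriv j F A| ≤ a j) (hH : ∀ u j A, |discDeriv u (discDeriv j F) A| ≤ H u j)
    (S : Finset ι) :
    ∃ (G : Set ι → ℝ) (b : ι → Set ι → ℝ),
      (∀ A, F A = G A + ∑ j ∈ S, centered p j A * b j A) ∧
      (∀ j ∈ S, discDeriv j G = 0) ∧ (∀ j A, |discDeriv j G A| ≤ a j) ∧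
      (∀ u j A, |discDeriv u (discDeriv j G) A| ≤ H u j) ∧
      (∀ j, discDeriv j (b j) = 0) ∧ (∀ j A, |b j A| ≤ a j) ∧
      ∀ u j A, |discDeriv u (b j) A| ≤ H u j := by
  classical
  have ha0 : ∀ j, 0 ≤ a j := fun j => (abs_nonneg _).trans (ha j ∅)
  have hH0 : ∀ u j, 0 ≤ H u j := fun u j => (abs_nonneg _).trans (hH u j ∅)
  have hz : ∀ j : ι, discDeriv j (0 : Set ι → ℝ) = 0 := fun j => by funext A; simp [discDeriv]
  induction S using Finset.induction_on with
  | empty =>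
    refine ⟨F, fun _ => 0, by simp, by simp, ha, hH, hz, ?_, ?_⟩
    · simpa using ha0
    · simpa [hz] using hH0
  | insert i S hi ih =>
    obtain ⟨G, b, h1, h2, h3, h4, h5, h6, h7⟩ := ih
    have h3' : ∀ j A, |discDeriv j (avgAt p i G) A| ≤ a j := by
      intro j A
      by_cases hj : j = i
      · subst hj; simpa [discDeriv_avgAt_self] using ha0 j
      · rw [discDeriv_avgAt_comm p hj]
        exact abs_avgAt_le (hp0 i) (hp1 i) (h3 j) A
    -- Split the current remainder `G` along coordinate `i` by `eq_avgAt_add`: the average is the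
    -- new remainder, the difference the new coefficient.
    refine ⟨avgAt p i G, Function.update b i (discDeriv i G), ?_, ?_, h3', ?_, ?_, ?_, ?_⟩
    · intro A
      rw [Finset.sum_insert hi, Function.update_self, h1 A, eq_avgAt_add p i G A, add_assoc]
      congr 2
      refine Finset.sum_congr rfl fun j hj => ?_
      rw [Function.update_of_ne (by rintro rfl; exact hi hj)]
    · intro j hj
      by_cases hji : j = i
      · subst hji; exact discDeriv_avgAt_self p j G
      · rw [discDeriv_avgAt_comm p hji, h2 j ((Finset.mem_insert.1 hj).resolve_left hji)]
        funext A; simp [avgAt]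
    · intro u j A
      by_cases hj : j = i
      · subst hj; simpa [discDeriv_avgAt_self, hz] using hH0 u j
      · rw [discDeriv_avgAt_comm p hj]
        by_cases hu : u = i
        · subst hu; simpa [discDeriv_avgAt_self, hz] using hH0 u j
        · rw [discDeriv_avgAt_comm p hu]
          exact abs_avgAt_le (hp0 i) (hp1 i) (h4 u j) A
    · intro j
      by_cases hji : j = i
      · subst hji; rw [Function.update_self]; exact discDeriv_discDeriv_self j G
      · rw [Function.update_of_ne hji]; exact h5 j
    · intro j
      by_cases hji : j = i
      · subst hji; rw [Function.update_self]; exact h3 j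
      · rw [Function.update_of_ne hji]; exact h6 j
    · intro u j
      by_cases hji : j = i
      · subst hji; rw [Function.update_self]; exact h4 u j
      · rw [Function.update_of_ne hji]; exact h7 u j

namespace IsExpectation

variable {p : ι → ℝ} {E : (Set ι → ℝ) →ₗ[ℝ] ℝ} (hE : IsExpectation p E)
include hE

/-- The **Clark–Ocone formula** on the discrete cube, with bounds for its coefficients. -/
lemma exists_clarkOcone [Fintype ι]
    {a : ι → ℝ} {H : ι → ι → ℝ} {F : Set ι → ℝ}
    (ha : ∀ j A, |discDeriv j F A| ≤ a j)
    (hH : ∀ u j A, |discDeriv u (discDeriv j F) A| ≤ H u j) :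
    ∃ b : ι → Set ι → ℝ,
      (∀ A, F A = E F + ∑ j, centered p j A * b j A) ∧
      (∀ j, discDeriv j (b j) = 0) ∧ (∀ j A, |b j A| ≤ a j) ∧
      ∀ u j A, |discDeriv u (b j) A| ≤ H u j := by
  obtain ⟨G, b, h1, h2, -, -, h5, h6, h7⟩ :=
    exists_partial_clarkOcone hE.nonneg_prob hE.prob_le_one ha hH Finset.univ
  have hG : ∀ A, G A = G ∅ := eq_const_of_discDeriv_eq_zero fun j => h2 j (Finset.mem_univ j)
  have hEF : E F = G ∅ := by
    have : F = fun A => G ∅ + ∑ j, centered p j A * b j A := by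
      funext A; rw [← hG A]; exact h1 A
    rw [this, map_fun_add, hE.map_const, map_fun_sum]
    simp only [add_eq_left]
    refine Finset.sum_eq_zero fun j _ => ?_
    have := hE.map_centered_mul j (h5 j) (fun _ => 1)
    simp only [mul_one] at this
    rw [this, show discDeriv j (fun _ : Set ι => (1 : ℝ)) = 0 by funext; simp [discDeriv]]
    simp only [Pi.zero_apply, mul_zero]
    rw [hE.map_const, mul_zero]
  exact ⟨b, fun A => by rw [hEF, ← hG A]; exact h1 A, h5, h6, h7⟩

/-- The covariance formula obtained from a Clark–Ocone decomposition of `F`. -/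
lemma map_mul_sub_of_clarkOcone [Fintype ι] {F : Set ι → ℝ} {b : ι → Set ι → ℝ}
    (hF : ∀ A, F A = E F + ∑ j, centered p j A * b j A) (hb : ∀ j, discDeriv j (b j) = 0)
    (G : Set ι → ℝ) :
    E (fun A => G A * (F A - E F))
      = E (fun A => ∑ j, p j * (1 - p j) * (b j A * discDeriv j G A)) := by
  have h : (fun A => G A * (F A - E F)) = fun A => ∑ j, centered p j A * b j A * G A := by
    funext A
    rw [← Finset.sum_mul, mul_comm, hF A, add_sub_cancel_left]
  rw [h, map_fun_sum, map_fun_sum]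
  exact Finset.sum_congr rfl fun j _ => by rw [hE.map_centered_mul j (hb j), map_fun_mul]

/-- A **Poincaré inequality** on the discrete cube for uniformly bounded differences. -/
lemma variance_le [Fintype ι] {F : Set ι → ℝ} {a : ι → ℝ}
    (ha : ∀ j A, |discDeriv j F A| ≤ a j) :
    E (fun A => (F A - E F) ^ 2) ≤ ∑ j, p j * a j ^ 2 := by
  -- Only first differences matter here; `a j + a j` is a trivial bound on the second ones, fed in
  -- and discarded.
  obtain ⟨b, h1, h2, h3, -⟩ := hE.exists_clarkOcone (F := F) (H := fun u j => a j + a j) ha (by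
    intro u j A
    exact (abs_sub _ _).trans (add_le_add (ha _ _) (ha _ _)))
  have h4 := hE.map_mul_sub_of_clarkOcone h1 h2 (fun A => F A - E F)
  simp_rw [← sq] at h4
  rw [h4, ← hE.map_const (∑ j, p j * a j ^ 2)]
  refine hE.mono fun A => Finset.sum_le_sum fun j _ => ?_
  have h5 : discDeriv j (fun A => F A - E F) A = discDeriv j F A := by simp [discDeriv]
  rw [h5]
  have h6 : b j A * discDeriv j F A ≤ a j ^ 2 := by
    refine (le_abs_self _).trans ?_
    rw [abs_mul, sq]
    exact mul_le_mul (h3 j A) (ha j A) (abs_nonneg _) ((abs_nonneg _).trans (h3 j A))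
  have h7 := hE.nonneg_prob j
  have h8 := hE.prob_le_one j
  have h9 : p j * (1 - p j) ≤ p j := by nlinarith
  calc _ ≤ p j * (1 - p j) * a j ^ 2 :=
        mul_le_mul_of_nonneg_left h6 (mul_nonneg h7 (sub_nonneg.2 h8))
    _ ≤ _ := mul_le_mul_of_nonneg_right h9 (sq_nonneg _)

/-- The variance is at least that of the projection to the linear functions. -/
lemma le_variance [Fintype ι] (F : Set ι → ℝ) :
    ∑ j, p j * (1 - p j) * E (discDeriv j F) ^ 2 ≤ E (fun A => (F A - E F) ^ 2) := by
  set d : ι → ℝ := fun j => E (discDeriv j F)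
  set L : Set ι → ℝ := fun A => ∑ j, centered p j A * d j
  have hd : ∀ j, discDeriv j (fun _ : Set ι => d j) = 0 := fun j => by funext; simp [discDeriv]
  have key : ∀ G : Set ι → ℝ, E (fun A => L A * G A)
      = ∑ j, p j * (1 - p j) * (d j * E (discDeriv j G)) := by
    intro G
    simp_rw [L, Finset.sum_mul]
    rw [map_fun_sum]
    refine Finset.sum_congr rfl fun j _ => ?_
    rw [hE.map_centered_mul j (hd j), map_fun_mul]
  have hL : ∀ j, discDeriv j L = fun _ => d j := by
    classical
    intro j
    funext A
    simp only [discDeriv, L]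
    rw [← Finset.sum_sub_distrib, Finset.sum_eq_single j]
    · simp [centered]
      ring
    · intro k _ hk
      simp [centered, hk]
    · simp
  have h1 := key L
  have h2 := key (fun A => F A - E F)
  -- `L` is the linear projection: its second moment equals its covariance with `F`, so expanding
  -- this square gives the claim.
  have h0 := hE.nonneg (fun A => (F A - E F - L A) ^ 2) (fun _ => sq_nonneg _)
  have h3 : (fun A => (F A - E F - L A) ^ 2)
      = fun A => ((F A - E F) ^ 2 + L A * L A) - 2 * (L A * (F A - E F)) := by
    funext A; ring
  rw [h3, map_fun_sub, map_fun_add, map_fun_mul, h1, h2] at h0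
  have h4 : ∀ j, discDeriv j (fun A => F A - E F) = discDeriv j F := by
    intro j; funext A; simp [discDeriv]
  simp_rw [h4, hL, hE.map_const] at h0
  have h5 : ∀ j, p j * (1 - p j) * (d j * E (discDeriv j F)) = p j * (1 - p j) * d j ^ 2 := by
    intro j; simp only [d]; ring
  have h6 : ∀ j, p j * (1 - p j) * (d j * d j) = p j * (1 - p j) * d j ^ 2 := by
    intro j; ring
  simp_rw [h5, h6] at h0
  linarith

/-- Second moment bound for the discrete Ornstein–Uhlenbeck generator applied to `F`. -/
lemma map_generator_sq_le [Fintype ι] {F : Set ι → ℝ} {a : ι → ℝ} {H : ι → ι → ℝ}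
    (ha : ∀ j A, |discDeriv j F A| ≤ a j)
    (hH : ∀ u j A, |discDeriv u (discDeriv j F) A| ≤ H u j) :
    E (fun A => (∑ j, centered p j A * discDeriv j F A) ^ 2)
      ≤ ∑ j, p j * (a j ^ 2 + ∑ k, p k * H k j ^ 2) := by
  classical
  set L : Set ι → ℝ := fun A => ∑ j, centered p j A * discDeriv j F A
  -- Commutation relation: the difference of `L` produces an extra `discDeriv j F` from the centered
  -- indicator of `j`. The term `k = j` vanishes as `discDeriv j F` ignores `j`.
  have hL : ∀ j A, discDeriv j L A
      = discDeriv j F A + ∑ k, centered p k A * (if k = j then 0 else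
        discDeriv k (discDeriv j F) A) := by
    intro j A
    simp only [L]
    rw [discDeriv, ← Finset.sum_sub_distrib,
      ← Finset.add_sum_erase _ _ (Finset.mem_univ j),
      ← Finset.add_sum_erase Finset.univ _ (Finset.mem_univ j), if_pos rfl, mul_zero, zero_add]
    congr 1
    · simp [centered, discDeriv]
      ring
    · refine Finset.sum_congr rfl fun k hk => ?_
      have hkj := Finset.ne_of_mem_erase hk
      rw [if_neg hkj]
      simp only [centered, discDeriv, Set.mem_insert_iff, hkj, false_or, Set.mem_sdiff,
        Set.mem_singleton_iff, not_false_eq_true, and_true, Set.insert_comm j k,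
        insert_sdiff_comm hkj, insert_sdiff_comm (Ne.symm hkj), Set.sdiff_sdiff_comm (u := {k})]
      ring
  have h1 : E (fun A => L A ^ 2) = E (fun A => ∑ j, p j * (1 - p j) *
      (discDeriv j F A * discDeriv j L A)) := by
    have : (fun A => L A ^ 2) = fun A => ∑ j, centered p j A * discDeriv j F A * L A := by
      funext A; rw [← Finset.sum_mul, sq]
    rw [this, map_fun_sum, map_fun_sum]
    exact Finset.sum_congr rfl fun j _ => by
      rw [hE.map_centered_mul j (discDeriv_discDeriv_self j F), map_fun_mul]
  rw [h1, map_fun_sum]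
  refine Finset.sum_le_sum fun j _ => ?_
  rw [map_fun_mul]
  have hp0 := hE.nonneg_prob
  have hp1 := hE.prob_le_one
  have hpq0 : ∀ k, 0 ≤ p k * (1 - p k) := fun k => mul_nonneg (hp0 k) (sub_nonneg.2 (hp1 k))
  have hpq : ∀ k, p k * (1 - p k) ≤ p k := fun k => by nlinarith [hp0 k, hp1 k]
  have h2 : E (fun A => discDeriv j F A * discDeriv j L A) ≤ a j ^ 2 + ∑ k, p k * H k j ^ 2 := by
    have h3 : (fun A => discDeriv j F A * discDeriv j L A)
        = fun A => discDeriv j F A ^ 2 + ∑ k, centered p k A *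
          (if k = j then 0 else discDeriv k (discDeriv j F) A) * discDeriv j F A := by
      funext A; rw [hL, ← Finset.sum_mul]; ring
    rw [h3, map_fun_add, map_fun_sum]
    refine add_le_add ?_ (Finset.sum_le_sum fun k _ => ?_)
    · rw [← hE.map_const (a j ^ 2)]
      exact hE.mono fun A => sq_le_sq' (abs_le.1 (ha j A)).1 (abs_le.1 (ha j A)).2
    · by_cases hk : k = j
      · simp only [hk, if_true, mul_zero, zero_mul, hE.map_const]
        exact mul_nonneg (hp0 j) (sq_nonneg _)
      · simp only [hk, if_false]
        -- A second integration by parts, now in `k`, turns the cross term into a squared second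
        -- difference.
        rw [hE.map_centered_mul k (discDeriv_discDeriv_self k _)]
        refine mul_le_mul (hpq k) ?_ (hE.nonneg _ fun A => mul_self_nonneg _) (hp0 k)
        rw [← hE.map_const (H k j ^ 2)]
        refine hE.mono fun A => ?_
        rw [← sq]
        exact sq_le_sq' (abs_le.1 (hH k j A)).1 (abs_le.1 (hH k j A)).2
  have h4 : 0 ≤ a j ^ 2 + ∑ k, p k * H k j ^ 2 :=
    add_nonneg (sq_nonneg _) (Finset.sum_nonneg fun k _ => mul_nonneg (hp0 k) (sq_nonneg _))
  exact (mul_le_mul_of_nonneg_left h2 (hpq0 j)).trans (mul_le_mul_of_nonneg_right (hpq j) h4)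

end IsExpectation
end BernoulliCube

/-! ### Stein's method on the cube. -/

namespace BernoulliCube
namespace IsExpectation

variable {ι : Type*} {p : ι → ℝ} {E : (Set ι → ℝ) →ₗ[ℝ] ℝ} (hE : IsExpectation p E)
include hE

/-- Stein's method on the discrete cube. The functions `f` and `f'` stand for the solution of a
Stein equation and its derivative, whose oscillation is controlled by a monotone function `g`. -/
lemma abs_map_stein_le [Fintype ι] {F : Set ι → ℝ} {a B C σ : ℝ} {H : ι → ι → ℝ}
    {f f' g : ℝ → ℝ} (ha : ∀ j A, |discDeriv j F A| ≤ a)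
    (hH : ∀ u j A, |discDeriv u (discDeriv j F) A| ≤ H u j)
    (hB : ∀ u, ∑ j, p j * H u j ≤ B) (hC : ∀ j, ∑ k, p k * H k j ^ 2 ≤ C)
    (ha0 : 0 ≤ a) (hB0 : 0 ≤ B)
    (hσ : 0 < σ) (hvar : E (fun A => (F A - E F) ^ 2) = σ ^ 2)
    (hf' : ∀ x, |f' x| ≤ 2) (hg : ∀ x, |g x| ≤ 2)
    (hleft : ∀ x y, |f y - f x - f' x * (y - x)| ≤ (y - x) * (g y - g x)) :
    |E (fun A => f' ((F A - E F) / σ) - (F A - E F) / σ * f ((F A - E F) / σ))|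
      ≤ 2 * √(∑ j, p j) * (2 * a * B + a * √(a ^ 2 + C)) / σ ^ 2 := by
  obtain ⟨b, h1, h2, h3, h4⟩ := hE.exists_clarkOcone (a := fun _ => a) ha hH
  have hp0 := hE.nonneg_prob
  have hp1 := hE.prob_le_one
  have hS0 : 0 ≤ ∑ j, p j := Finset.sum_nonneg fun j _ => hp0 j
  have hpq0 : ∀ k, 0 ≤ p k * (1 - p k) := fun k => mul_nonneg (hp0 k) (sub_nonneg.2 (hp1 k))
  have hpq : ∀ k, p k * (1 - p k) ≤ p k := fun k => by nlinarith [hp0 k, hp1 k]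
  set W : Set ι → ℝ := fun A => (F A - E F) / σ with hW
  have hDW : ∀ j A, discDeriv j W A = discDeriv j F A / σ := by
    intro j A; simp only [W, discDeriv]; ring
  set T : Set ι → ℝ := fun A => ∑ j, p j * (1 - p j) * (b j A * discDeriv j F A) with hT
  have hET : E T = σ ^ 2 := by
    have := hE.map_mul_sub_of_clarkOcone h1 h2 (fun A => F A - E F)
    simp_rw [← sq, hvar] at this
    rw [this]
    congr 1; funext A
    refine Finset.sum_congr rfl fun j _ => ?_
    simp [discDeriv]
  have hDT : ∀ u A, |discDeriv u T A| ≤ 2 * a * B := by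
    intro u A
    calc |discDeriv u T A|
        = |∑ j, p j * (1 - p j) * (discDeriv u (b j) A * discDeriv j F (insert u A)
            + b j (A \ {u}) * discDeriv u (discDeriv j F) A)| := by
          congr 1
          rw [discDeriv, hT, ← Finset.sum_sub_distrib]
          refine Finset.sum_congr rfl fun j _ => ?_
          simp only [discDeriv]; ring
      _ ≤ ∑ j, p j * (2 * a * H u j) := by
          refine (Finset.abs_sum_le_sum_abs _ _).trans (Finset.sum_le_sum fun j _ => ?_)
          rw [abs_mul, abs_of_nonneg (hpq0 j)]
          refine mul_le_mul (hpq j) ?_ (abs_nonneg _) (hp0 j)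
          refine (abs_add_le _ _).trans ?_
          rw [abs_mul, abs_mul]
          have e1 : |discDeriv u (b j) A| * |discDeriv j F (insert u A)| ≤ H u j * a :=
            mul_le_mul (h4 u j A) (ha _ _) (abs_nonneg _) ((abs_nonneg _).trans (h4 u j A))
          have e2 : |b j (A \ {u})| * |discDeriv u (discDeriv j F) A| ≤ a * H u j :=
            mul_le_mul (h3 j _) (hH u j A) (abs_nonneg _) ha0
          linarith
      _ = 2 * a * ∑ j, p j * H u j := by
          rw [Finset.mul_sum]; exact Finset.sum_congr rfl fun j _ => by ring
      _ ≤ 2 * a * B := mul_le_mul_of_nonneg_left (hB u) (by positivity)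
  have hsdT : E (fun A => |T A - σ ^ 2|) ≤ √(∑ j, p j) * (2 * a * B) := by
    refine (hE.map_abs_le_sqrt _).trans ?_
    have := hE.variance_le hDT
    rw [hET, ← Finset.sum_mul] at this
    refine (Real.sqrt_le_sqrt this).trans ?_
    rw [Real.sqrt_mul hS0, Real.sqrt_sq (by positivity)]
  set L : Set ι → ℝ := fun A => ∑ j, centered p j A * discDeriv j F A with hL
  have hsdL : E (fun A => |L A|) ≤ √(∑ j, p j) * √(a ^ 2 + C) := by
    refine (hE.map_abs_le_sqrt _).trans ?_
    rw [← Real.sqrt_mul hS0]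
    refine Real.sqrt_le_sqrt ((hE.map_generator_sq_le ha hH).trans ?_)
    rw [Finset.sum_mul]
    exact Finset.sum_le_sum fun j _ =>
      mul_le_mul_of_nonneg_left (add_le_add le_rfl (hC j)) (hp0 j)
  -- `W A` is one of the two values in the difference; the Taylor bound allows either order of its
  -- endpoints, so both cases give the same product.
  have hrem : ∀ j A, |discDeriv j (fun A => f (W A)) A - f' (W A) * discDeriv j W A|
      ≤ discDeriv j W A * discDeriv j (fun A => g (W A)) A := by
    intro j A
    simp only [discDeriv]
    by_cases hj : j ∈ A
    · rw [Set.insert_eq_of_mem hj]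
      have := hleft (W A) (W (A \ {j}))
      calc _ = |f (W (A \ {j})) - f (W A) - f' (W A) * (W (A \ {j}) - W A)| := by
            rw [← abs_neg]; congr 1; ring
        _ ≤ _ := this
        _ = _ := by ring
    · rw [Set.sdiff_singleton_eq_self hj]
      exact hleft _ _
  have hWf : E (fun A => W A * f (W A))
      = σ⁻¹ * E (fun A => ∑ j, p j * (1 - p j) * (b j A * discDeriv j (fun A => f (W A)) A)) := by
    rw [← hE.map_mul_sub_of_clarkOcone h1 h2, ← map_fun_mul]
    congr 1; funext A; simp only [W]; field_simp
  set R : Set ι → ℝ := fun A => ∑ j, p j * (1 - p j) * (b j A *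
    (discDeriv j (fun A => f (W A)) A - f' (W A) * discDeriv j W A)) with hR
  have hdecomp : E (fun A => f' (W A) - W A * f (W A))
      = (σ ^ 2)⁻¹ * E (fun A => f' (W A) * (σ ^ 2 - T A)) - σ⁻¹ * E R := by
    rw [map_fun_sub, hWf, ← map_fun_mul, ← map_fun_mul, ← map_fun_mul, ← map_fun_sub,
      ← map_fun_sub]
    congr 1
    funext A
    have : ∑ j, p j * (1 - p j) * (b j A * discDeriv j (fun A => f (W A)) A)
        = R A + f' (W A) * T A / σ := by
      simp only [R, T, hDW]
      rw [Finset.mul_sum, Finset.sum_div, ← Finset.sum_add_distrib]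
      refine Finset.sum_congr rfl fun j _ => by ring
    rw [this]
    field_simp
    ring
  have hER : |E R| ≤ 2 * a / σ * (√(∑ j, p j) * √(a ^ 2 + C)) := by
    calc |E R| ≤ E (fun A => |R A|) := hE.abs_map_le R
      _ ≤ E (fun A => ∑ j, a * (p j * (1 - p j) *
            (discDeriv j F A * discDeriv j (fun A => σ⁻¹ * g (W A)) A))) := by
          refine hE.mono fun A => (Finset.abs_sum_le_sum_abs _ _).trans
            (Finset.sum_le_sum fun j _ => ?_)
          rw [abs_mul, abs_of_nonneg (hpq0 j), abs_mul, mul_left_comm a]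
          refine mul_le_mul_of_nonneg_left ?_ (hpq0 j)
          refine mul_le_mul (h3 j A) ((hrem j A).trans_eq ?_) (abs_nonneg _) ha0
          rw [hDW]; simp only [discDeriv]; ring
      -- Now `discDeriv j F` serves as the coefficient that ignores `j`, so integration by parts
      -- runs backwards and removes the difference from `g`. Only the sup bound on `g` is then
      -- needed.
      _ = a / σ * E (fun A => L A * g (W A)) := by
          have e : (fun A => L A * g (W A))
              = fun A => ∑ j, centered p j A * discDeriv j F A * g (W A) := by
            funext A; rw [hL, Finset.sum_mul]
          rw [e, map_fun_sum, map_fun_sum, Finset.mul_sum]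
          refine Finset.sum_congr rfl fun j _ => ?_
          rw [hE.map_centered_mul j (discDeriv_discDeriv_self j F), ← map_fun_mul, ← map_fun_mul]
          congr 1; funext A; simp only [discDeriv]; ring
      _ ≤ a / σ * (2 * E (fun A => |L A|)) := by
          refine mul_le_mul_of_nonneg_left ?_ (by positivity)
          rw [← map_fun_mul]
          refine hE.mono fun A => (le_abs_self _).trans ?_
          rw [abs_mul, mul_comm]
          exact mul_le_mul_of_nonneg_right (hg _) (abs_nonneg _)
      _ ≤ a / σ * (2 * (√(∑ j, p j) * √(a ^ 2 + C))) := by gcongr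
      _ = _ := by ring
  have hfirst : |E (fun A => f' (W A) * (σ ^ 2 - T A))| ≤ 2 * (√(∑ j, p j) * (2 * a * B)) := by
    calc _ ≤ E (fun A => |f' (W A) * (σ ^ 2 - T A)|) := hE.abs_map_le _
      _ ≤ 2 * E (fun A => |T A - σ ^ 2|) := by
          rw [← map_fun_mul]
          refine hE.mono fun A => ?_
          rw [abs_mul, abs_sub_comm]
          exact mul_le_mul_of_nonneg_right (hf' _) (abs_nonneg _)
      _ ≤ _ := by gcongr
  change |E (fun A => f' (W A) - W A * f (W A))| ≤ _
  rw [hdecomp]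
  refine (abs_sub _ _).trans ?_
  rw [abs_mul, abs_mul, abs_of_nonneg (by positivity : 0 ≤ (σ ^ 2)⁻¹),
    abs_of_nonneg (by positivity : 0 ≤ σ⁻¹)]
  calc _ ≤ (σ ^ 2)⁻¹ * (2 * (√(∑ j, p j) * (2 * a * B)))
        + σ⁻¹ * (2 * a / σ * (√(∑ j, p j) * √(a ^ 2 + C))) := by gcongr
    _ = _ := by field_simp

end IsExpectation
end BernoulliCube

/-! ### The random subset measure as a cube expectation. -/

namespace BernoulliCube

variable {ι : Type*}

/-- Integration over a finite space, as a linear functional on all functions. -/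
noncomputable def expectation {Ω : Type*} [MeasurableSpace Ω] [MeasurableSingletonClass Ω]
    [Finite Ω] (P : Measure Ω) [IsFiniteMeasure P] : (Ω → ℝ) →ₗ[ℝ] ℝ where
  toFun F := ∫ ω, F ω ∂P
  map_add' _ _ := integral_add .of_finite .of_finite
  map_smul' c F := integral_const_mul c F

lemma expectation_apply {Ω : Type*} [MeasurableSpace Ω] [MeasurableSingletonClass Ω]
    [Finite Ω] (P : Measure Ω) [IsFiniteMeasure P] (F : Ω → ℝ) :
    expectation P F = ∫ ω, F ω ∂P := rfl

open Classical in
-- Detailed balance between a set and the same set with `j` added; this is all of independence that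
-- `map_avgAt` needs.
lemma setBernoulli_real_insert [Finite ι] (u : Set ι) (p : unitInterval) {j : ι} {s : Set ι}
    (hj : j ∉ s) :
    (1 - if j ∈ u then (p : ℝ) else 0) * (setBernoulli u p).real {insert j s}
      = (if j ∈ u then (p : ℝ) else 0) * (setBernoulli u p).real {s} := by
  by_cases hju : j ∈ u
  · simp only [hju, if_true]
    by_cases hs : s ⊆ u
    · rw [setBernoulli_real_singleton p (Set.insert_subset hju hs) u.toFinite,
        setBernoulli_real_singleton p hs u.toFinite, Set.ncard_insert_of_notMem hj s.toFinite]
      have h1 : u \ s = insert j (u \ insert j s) := by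
        ext x
        by_cases hx : x = j
        · subst hx; simp [hju, hj]
        · simp [hx]
      rw [h1, Set.ncard_insert_of_notMem (by simp) (Set.toFinite _)]
      ring
    · have hs' : ¬ insert j s ⊆ u := fun h => hs ((Set.subset_insert _ _).trans h)
      simp [measureReal_def, setBernoulli_singleton_of_not_subset p hs,
        setBernoulli_singleton_of_not_subset p hs']
  · have hs' : ¬ insert j s ⊆ u := fun h => hju (h (Set.mem_insert _ _))
    simp [measureReal_def, hju, setBernoulli_singleton_of_not_subset p hs']

open Classical in
lemma isExpectation_setBernoulli [Finite ι] (u : Set ι) (p : unitInterval) :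
    IsExpectation (fun j => if j ∈ u then (p : ℝ) else 0) (expectation (setBernoulli u p)) where
  nonneg_prob j := by split_ifs; exacts [p.2.1, le_rfl]
  prob_le_one j := by split_ifs; exacts [p.2.2, zero_le_one]
  nonneg F hF := integral_nonneg hF
  map_one := by simp [expectation_apply]
  map_avgAt j F := by
    have := Fintype.ofFinite ι
    simp only [expectation_apply]
    rw [integral_fintype .of_finite, integral_fintype .of_finite]
    simp only [smul_eq_mul]
    have hinv : Function.Involutive fun s : Set ι => if j ∈ s then s \ {j} else insert j s := by
      intro s
      by_cases h : j ∈ s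
      · simp [h]
      · simp [h]
    -- Pairing each set with its toggle at `j` reduces the invariance under averaging to an identity
    -- for each pair.
    have hsum : ∀ G : Set ι → ℝ,
        2 * ∑ s, G s = ∑ s, (G s + G (if j ∈ s then s \ {j} else insert j s)) := by
      intro G
      rw [Finset.sum_add_distrib, two_mul]
      congr 1
      exact (Equiv.sum_comp hinv.toPerm G).symm
    refine mul_left_cancel₀ (two_ne_zero (α := ℝ)) ?_
    rw [hsum, hsum]
    refine Finset.sum_congr rfl fun s _ => ?_
    set q : ℝ := if j ∈ u then (p : ℝ) else 0 with hq
    by_cases h : j ∈ s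
    · have hw := setBernoulli_real_insert u p (j := j) (s := s \ {j}) (by simp)
      rw [Set.insert_sdiff_singleton, Set.insert_eq_of_mem h, ← hq] at hw
      simp only [h, if_true, avgAt, ← hq, Set.insert_sdiff_singleton, Set.insert_eq_of_mem,
        sdiff_idem]
      linear_combination (F (s \ {j}) - F s) * hw
    · have hw := setBernoulli_real_insert u p (j := j) (s := s) h
      rw [← hq] at hw
      simp only [h, if_false, avgAt, ← hq, Set.insert_idem, Set.sdiff_singleton_eq_self h,
        Set.insert_sdiff_self_of_notMem h]
      linear_combination (F s - F (insert j s)) * hw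

open Classical in
lemma IsExpectation.map_disjoint {p : ι → ℝ} {E : (Set ι → ℝ) →ₗ[ℝ] ℝ} (hE : IsExpectation p E)
    (U : Finset ι) : E (fun A => if ∀ j ∈ U, j ∉ A then 1 else 0) = ∏ j ∈ U, (1 - p j) := by
  induction U using Finset.induction_on with
  | empty => simpa using hE.map_one
  | insert i U hi ih =>
    rw [Finset.prod_insert hi, ← ih, ← hE.map_avgAt i, ← map_fun_mul]
    congr 1
    funext A
    have h : (∀ j ∈ U, j ∈ A → j = i) ↔ ∀ j ∈ U, j ∉ A :=
      forall₂_congr fun j hj => ⟨fun h h' => hi (h h' ▸ hj), fun h h' => absurd h' h⟩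
    simp [avgAt, h]

end BernoulliCube

/-! ### Differences of the number of isolated faces. -/

namespace RandomComplex

open BernoulliCube

/-- No `κ`-face in `A` contains `s`. -/
def IsUncovered (κ : ℕ) {n : ℕ} (A : Set (Finset (Fin n))) (s : Finset (Fin n)) : Prop :=
  ∀ t ∈ A, t.card = κ + 1 → ¬ s ⊆ t

open Classical in
lemma numIsolatedFaces_eq {κ n : ℕ} (hκ : 1 ≤ κ) (A : Set (Finset (Fin n))) :
    numIsolatedFaces κ n A
      = ∑ s ∈ Finset.powersetCard κ Finset.univ, if IsUncovered κ A s then (1 : ℝ) else 0 := by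
  rw [numIsolatedFaces, Finset.sum_boole, ← Set.ncard_coe_finset]
  congr 2
  ext s
  simp only [IsIsolatedFace, Set.mem_ofPred_eq, Finset.coe_filter, Finset.mem_powersetCard,
    Finset.subset_univ, true_and]
  have hmem : ∀ t, t ∈ complexOf κ n A ↔ (t.Nonempty ∧ t.card ≤ κ) ∨ (t ∈ A ∧ t.card = κ + 1) :=
    fun t => Iff.rfl
  simp only [hmem, IsUncovered]
  constructor
  · rintro ⟨-, h2, h3⟩
    exact ⟨h2, fun t ht htc => h3 t (Or.inr ⟨ht, htc⟩) htc⟩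
  · rintro ⟨h2, h3⟩
    refine ⟨Or.inl ⟨Finset.card_pos.1 (by omega), h2.le⟩, h2, ?_⟩
    rintro t (⟨-, h⟩ | ⟨h, -⟩) htc
    · omega
    · exact h3 t h htc

lemma isUncovered_insert_iff {κ n : ℕ} (A : Set (Finset (Fin n))) (s t : Finset (Fin n)) :
    IsUncovered κ (insert t A) s ↔ ¬ (t.card = κ + 1 ∧ s ⊆ t) ∧ IsUncovered κ (A \ {t}) s := by
  simp only [IsUncovered]
  constructor
  · exact fun h => ⟨fun ht => h t (Set.mem_insert _ _) ht.1 ht.2,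
      fun v hv => h v (Set.mem_insert_of_mem _ hv.1)⟩
  · rintro ⟨h1, h2⟩ v hv hc hs
    by_cases hvt : v = t
    · subst hvt; exact h1 ⟨hc, hs⟩
    · exact h2 v ⟨hv.resolve_left hvt, hvt⟩ hc hs

open Classical in
lemma discDeriv_uncovered {κ n : ℕ} (A : Set (Finset (Fin n))) (s t : Finset (Fin n)) :
    discDeriv t (fun A => if IsUncovered κ A s then (1 : ℝ) else 0) A
      = -(if t.card = κ + 1 ∧ s ⊆ t then
        (if IsUncovered κ (A \ {t}) s then (1 : ℝ) else 0) else 0) := by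
  simp only [discDeriv, isUncovered_insert_iff]
  split_ifs <;> simp_all

open Classical in
lemma discDeriv_numIsolatedFaces {κ n : ℕ} (hκ : 1 ≤ κ) (t : Finset (Fin n)) :
    discDeriv t (numIsolatedFaces κ n) = fun A => -(if t.card = κ + 1 then
      ∑ s ∈ Finset.powersetCard κ t, (if IsUncovered κ (A \ {t}) s then (1 : ℝ) else 0) else 0) := by
  funext A
  have h : discDeriv t (numIsolatedFaces κ n) A = ∑ s ∈ Finset.powersetCard κ Finset.univ,
      discDeriv t (fun A => if IsUncovered κ A s then (1 : ℝ) else 0) A := by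
    simp only [discDeriv, numIsolatedFaces_eq hκ, Finset.sum_sub_distrib]
  rw [h]
  simp only [discDeriv_uncovered, Finset.sum_neg_distrib, neg_inj]
  by_cases ht : t.card = κ + 1
  · simp only [ht, true_and, if_true]
    rw [← Finset.sum_filter]
    refine Finset.sum_congr ?_ fun _ _ => rfl
    ext s; simp [Finset.mem_powersetCard, and_comm]
  · simp [ht]

lemma abs_discDeriv_numIsolatedFaces_le {κ n : ℕ} (hκ : 1 ≤ κ) (t : Finset (Fin n))
    (A : Set (Finset (Fin n))) : |discDeriv t (numIsolatedFaces κ n) A| ≤ κ + 1 := by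
  classical
  rw [discDeriv_numIsolatedFaces hκ]
  simp only [abs_neg]
  split_ifs with ht
  · refine (Finset.abs_sum_le_sum_abs _ _).trans ((Finset.sum_le_card_nsmul _ _ 1 ?_).trans ?_)
    · intro s _; split_ifs <;> simp
    · simp [Finset.card_powersetCard, ht]
  · rw [abs_zero]; positivity

open Classical in
/-- The number of `(κ-1)`-faces that the `κ`-faces `u` and `t` have in common. -/
noncomputable def commonFaces (κ : ℕ) {n : ℕ} (u t : Finset (Fin n)) : ℝ :=
  if t.card = κ + 1 then
    ∑ s ∈ Finset.powersetCard κ t, (if u.card = κ + 1 ∧ s ⊆ u then (1 : ℝ) else 0) else 0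

lemma commonFaces_nonneg (κ : ℕ) {n : ℕ} (u t : Finset (Fin n)) : 0 ≤ commonFaces κ u t := by
  classical
  unfold commonFaces
  split_ifs
  · exact Finset.sum_nonneg fun s _ => by split_ifs <;> norm_num
  · exact le_rfl

lemma commonFaces_le (κ : ℕ) {n : ℕ} (u t : Finset (Fin n)) : commonFaces κ u t ≤ κ + 1 := by
  classical
  unfold commonFaces
  split_ifs with ht
  · refine (Finset.sum_le_card_nsmul _ _ 1 ?_).trans ?_
    · intro s _; split_ifs <;> simp
    · simp [Finset.card_powersetCard, ht]
  · positivity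

/-- Toggling `u` affects the difference at `t` only through those facets of `t` that also lie in
`u`. -/
lemma abs_discDeriv_discDeriv_numIsolatedFaces_le {κ n : ℕ} (hκ : 1 ≤ κ) (u t : Finset (Fin n))
    (A : Set (Finset (Fin n))) :
    |discDeriv u (discDeriv t (numIsolatedFaces κ n)) A| ≤ commonFaces κ u t := by
  classical
  by_cases hut : u = t
  · subst hut
    rw [discDeriv_discDeriv_self, Pi.zero_apply, abs_zero]
    exact commonFaces_nonneg κ u u
  · rw [discDeriv_numIsolatedFaces hκ]
    unfold commonFaces
    by_cases ht : t.card = κ + 1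
    · simp only [discDeriv, ht, if_true]
      rw [neg_sub_neg, ← Finset.sum_sub_distrib]
      refine (Finset.abs_sum_le_sum_abs _ _).trans (Finset.sum_le_sum fun s _ => ?_)
      have h := discDeriv_uncovered (κ := κ) (A \ {t}) s u
      simp only [discDeriv, insert_sdiff_comm hut, Set.sdiff_sdiff_comm (u := {u})] at h
      rw [abs_sub_comm, Set.sdiff_sdiff_comm (u := {t}), Set.sdiff_sdiff_comm, h, abs_neg]
      split_ifs <;> simp
    · simp [discDeriv, ht]

lemma card_filter_superset_le {κ n : ℕ} {s : Finset (Fin n)} (hs : s.card = κ) :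
    (Finset.univ.filter fun u : Finset (Fin n) => u.card = κ + 1 ∧ s ⊆ u).card ≤ n := by
  classical
  have h : (Finset.univ.filter fun u : Finset (Fin n) => u.card = κ + 1 ∧ s ⊆ u)
      ⊆ Finset.univ.image fun v => insert v s := by
    intro u hu
    obtain ⟨hc, hsu⟩ := (Finset.mem_filter.1 hu).2
    obtain ⟨v, hv⟩ := Finset.card_eq_one.1
      (show (u \ s).card = 1 by rw [Finset.card_sdiff_of_subset hsu]; omega)
    refine Finset.mem_image.2 ⟨v, Finset.mem_univ _, ?_⟩
    rw [Finset.insert_eq, ← hv, Finset.sdiff_union_of_subset hsu]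
  exact (Finset.card_le_card h).trans (Finset.card_image_le.trans (by simp))

lemma sum_commonFaces_le (κ : ℕ) {n : ℕ} (t : Finset (Fin n)) :
    ∑ u, commonFaces κ u t ≤ (κ + 1) * n := by
  classical
  unfold commonFaces
  by_cases ht : t.card = κ + 1
  · simp only [ht, if_true]
    rw [Finset.sum_comm]
    refine (Finset.sum_le_card_nsmul _ _ (n : ℝ) fun s hs => ?_).trans ?_
    · rw [Finset.sum_boole]
      exact_mod_cast card_filter_superset_le (Finset.mem_powersetCard.1 hs).2
    · simp [Finset.card_powersetCard, ht]
  · simp only [ht, if_false, Finset.sum_const_zero]; positivity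

lemma commonFaces_comm (κ : ℕ) {n : ℕ} (u t : Finset (Fin n)) :
    commonFaces κ u t = commonFaces κ t u := by
  classical
  unfold commonFaces
  by_cases hu : u.card = κ + 1 <;> by_cases ht : t.card = κ + 1
  · simp only [hu, ht, if_true, true_and, Finset.sum_boole]
    congr 2
    ext s
    simp only [Finset.mem_filter, Finset.mem_powersetCard]
    tauto
  all_goals simp [hu, ht]

end RandomComplex

/-! ### Variance bound and Berry–Esseen estimate. -/

namespace RandomComplex

open BernoulliCube SteinSolution

section
variable {κ n : ℕ} (p : unitInterval)

open Classical in
/-- The probability that a set of vertices is selected as a `κ`-face. -/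
noncomputable def faceProb (κ n : ℕ) (p : unitInterval) (t : Finset (Fin n)) : ℝ :=
  if t ∈ simplexFaces κ n then (p : ℝ) else 0

/-- The expectation of functions of the random `κ`-complex. -/
noncomputable def faceExpectation (κ n : ℕ) (p : unitInterval) :
    (Set (Finset (Fin n)) → ℝ) →ₗ[ℝ] ℝ :=
  expectation (setBernoulli (simplexFaces κ n) p)

lemma isExpectation_faceExpectation : IsExpectation (faceProb κ n p) (faceExpectation κ n p) :=
  isExpectation_setBernoulli _ p

lemma faceProb_le (t : Finset (Fin n)) : faceProb κ n p t ≤ p := by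
  unfold faceProb; split_ifs; exacts [le_rfl, p.2.1]

lemma sum_faceProb : ∑ t, faceProb κ n p t = n.choose (κ + 1) * p := by
  classical
  unfold faceProb
  rw [← Finset.sum_filter, Finset.sum_const, nsmul_eq_mul]
  congr 2
  have : (Finset.univ.filter fun t => t ∈ simplexFaces κ n)
      = Finset.powersetCard (κ + 1) Finset.univ := by
    ext t
    rw [Finset.mem_filter, Finset.mem_powersetCard]
    exact ⟨fun h => ⟨Finset.subset_univ _, h.2⟩, fun h => ⟨Finset.mem_univ _, h.2⟩⟩
  rw [this, Finset.card_powersetCard, Finset.card_univ, Fintype.card_fin]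

lemma sum_faceProb_mul_commonFaces_le (t : Finset (Fin n)) :
    ∑ u, faceProb κ n p u * commonFaces κ u t ≤ (κ + 1) * (n * p) := by
  calc _ ≤ ∑ u, (p : ℝ) * commonFaces κ u t := Finset.sum_le_sum fun u _ =>
        mul_le_mul_of_nonneg_right (faceProb_le p u) (commonFaces_nonneg κ u t)
    _ ≤ p * ((κ + 1) * n) := by
        rw [← Finset.mul_sum]
        exact mul_le_mul_of_nonneg_left (sum_commonFaces_le κ t) p.2.1
    _ = _ := by ring

lemma sum_faceProb_mul_commonFaces_sq_le (t : Finset (Fin n)) :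
    ∑ u, faceProb κ n p u * commonFaces κ u t ^ 2 ≤ (κ + 1) * ((κ + 1) * (n * p)) := by
  refine le_trans ?_ (mul_le_mul_of_nonneg_left (sum_faceProb_mul_commonFaces_le p t)
    (by positivity))
  rw [Finset.mul_sum]
  refine Finset.sum_le_sum fun u _ => ?_
  have h0 := (isExpectation_faceExpectation (κ := κ) p).nonneg_prob u
  calc _ = faceProb κ n p u * commonFaces κ u t * commonFaces κ u t := by ring
    _ ≤ faceProb κ n p u * commonFaces κ u t * (κ + 1) :=
        mul_le_mul_of_nonneg_left (commonFaces_le κ u t) (mul_nonneg h0 (commonFaces_nonneg κ u t))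
    _ = _ := by ring

/-- At most `n` sets of size `κ + 1` contain `s`, and by independence all are absent with at least
this probability; removing `t` only helps. -/
lemma pow_le_faceExpectation_uncovered {s : Finset (Fin n)} (hs : s.card = κ)
    (t : Finset (Fin n)) : (1 - (p : ℝ)) ^ n ≤ faceExpectation κ n p
      (fun A => open Classical in if IsUncovered κ (A \ {t}) s then 1 else 0) := by
  classical
  have hE := isExpectation_faceExpectation (κ := κ) (n := n) p
  set U := Finset.univ.filter fun u : Finset (Fin n) => u.card = κ + 1 ∧ s ⊆ u
  have h1 : (0 : ℝ) ≤ 1 - p := sub_nonneg.2 p.2.2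
  calc (1 - (p : ℝ)) ^ n ≤ (1 - (p : ℝ)) ^ U.card :=
        pow_le_pow_of_le_one h1 (sub_le_self _ p.2.1) (card_filter_superset_le hs)
    _ ≤ ∏ u ∈ U, (1 - faceProb κ n p u) := by
        rw [← Finset.prod_const]
        exact Finset.prod_le_prod (fun _ _ => h1) fun u _ => sub_le_sub_left (faceProb_le p u) _
    _ = _ := (hE.map_disjoint U).symm
    _ ≤ _ := by
        refine hE.mono fun A => ?_
        have : (∀ u ∈ U, u ∉ A) → IsUncovered κ (A \ {t}) s := fun h v hv hc hsv =>
          h v (Finset.mem_filter.2 ⟨Finset.mem_univ _, hc, hsv⟩) hv.1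
        by_cases h : ∀ u ∈ U, u ∉ A
        · rw [if_pos h, if_pos (this h)]
        · rw [if_neg h]; split_ifs <;> norm_num

/-- Differences of `I` are nonpositive, so their means do not cancel: each `κ`-face contributes at
least `p * (1 - p)` times the square of `(1 - p) ^ n` to the linear projection. -/
lemma le_variance_numIsolatedFaces (hκ : 1 ≤ κ) :
    n.choose (κ + 1) * (p : ℝ) * (1 - (p : ℝ)) ^ (2 * n + 1) ≤
      faceExpectation κ n p (fun A => (numIsolatedFaces κ n A
        - faceExpectation κ n p (numIsolatedFaces κ n)) ^ 2) := by
  classical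
  have hE := isExpectation_faceExpectation (κ := κ) (n := n) p
  have h1 : (0 : ℝ) ≤ 1 - p := sub_nonneg.2 p.2.2
  refine le_trans ?_ (hE.le_variance _)
  rw [← sum_faceProb, Finset.sum_mul]
  refine Finset.sum_le_sum fun t _ => ?_
  by_cases ht : t.card = κ + 1
  · have hp : faceProb κ n p t = p := by simp [faceProb, simplexFaces, ht]
    rw [hp, pow_succ', mul_assoc, pow_mul', sq ((1 - (p : ℝ)) ^ n), ← sq]
    refine mul_le_mul_of_nonneg_left (mul_le_mul_of_nonneg_left ?_ h1) p.2.1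
    have h2 : (1 - (p : ℝ)) ^ n
        ≤ -faceExpectation κ n p (discDeriv t (numIsolatedFaces κ n)) := by
      rw [discDeriv_numIsolatedFaces hκ, ← map_neg]
      have : (-fun A => -(if t.card = κ + 1 then ∑ s ∈ Finset.powersetCard κ t,
          (if IsUncovered κ (A \ {t}) s then (1 : ℝ) else 0) else 0))
          = fun A => ∑ s ∈ Finset.powersetCard κ t,
            (if IsUncovered κ (A \ {t}) s then (1 : ℝ) else 0) := by
        funext A; simp [ht]
      rw [this, map_fun_sum]
      -- One of the `κ + 1` facets suffices; the factor `κ + 1` is dropped.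
      calc (1 - (p : ℝ)) ^ n ≤ (Finset.powersetCard κ t).card • (1 - (p : ℝ)) ^ n := by
            rw [Finset.card_powersetCard, ht, nsmul_eq_mul]
            refine le_mul_of_one_le_left (pow_nonneg h1 n) ?_
            simp
        _ ≤ _ := Finset.card_nsmul_le_sum _ _ _ fun s hs =>
            pow_le_faceExpectation_uncovered p (Finset.mem_powersetCard.1 hs).2 t
    rw [← neg_sq (faceExpectation κ n p _)]
    exact pow_le_pow_left₀ (pow_nonneg h1 n) h2 2
  · have hp : faceProb κ n p t = 0 := by simp [faceProb, simplexFaces, ht]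
    simp [hp]

/-- A non-asymptotic Berry–Esseen bound for the number of isolated faces. -/
lemma kolmogorovDist_numIsolatedFaces_le (hκ : 1 ≤ κ) (hp1 : (p : ℝ) < 1)
    (hS : 0 < n.choose (κ + 1) * (p : ℝ))
    {Ω' : Type*} [MeasurableSpace Ω'] {Q : Measure Ω'} {N : Ω' → ℝ}
    (hN : HasLaw N (gaussianReal 0 1) Q) :
    kolmogorovDist (normalized (numIsolatedFaces κ n) (faceMeasure κ n p)) (faceMeasure κ n p) N Q
      ≤ 2 * (2 * (κ + 1) * ((κ + 1) * (n * p))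
          + (κ + 1) * √((κ + 1) ^ 2 + (κ + 1) * ((κ + 1) * (n * p))))
        / (√(n.choose (κ + 1) * p) * (1 - (p : ℝ)) ^ (2 * n + 1)) := by
  classical
  have hE := isExpectation_faceExpectation (κ := κ) (n := n) p
  set E := faceExpectation κ n p with hEdef
  set I := numIsolatedFaces κ n with hI
  have hp0 : (0 : ℝ) ≤ p := p.2.1
  have hint : ∀ F, ∫ A, F A ∂(faceMeasure κ n p) = E F := fun F => rfl
  have : IsProbabilityMeasure (faceMeasure κ n p) := by unfold faceMeasure; infer_instance
  have hvar : variance I (faceMeasure κ n p) = E (fun A => (I A - E I) ^ 2) :=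
    variance_eq_integral AEMeasurable.of_discrete
  set v := E (fun A => (I A - E I) ^ 2) with hv
  have hlow := le_variance_numIsolatedFaces (n := n) p hκ
  have hpow : 0 < (1 - (p : ℝ)) ^ (2 * n + 1) := pow_pos (sub_pos.2 hp1) _
  have hv0 : 0 < v := (mul_pos hS hpow).trans_le hlow
  set K : ℝ := 2 * (κ + 1) * ((κ + 1) * (n * p))
          + (κ + 1) * √((κ + 1) ^ 2 + (κ + 1) * ((κ + 1) * (n * p))) with hK
  have hK0 : 0 ≤ K := by positivity
  refine ciSup_le fun z => ?_
  have hQ : Q.real {ω | N ω ≤ z} = gaussCDF z := by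
    rw [gaussCDF, ← hN.map_eq, map_measureReal_apply_of_aemeasurable hN.aemeasurable
      measurableSet_Iic]
    rfl
  have hP : (faceMeasure κ n p).real {A | normalized I (faceMeasure κ n p) A ≤ z}
      = E (fun A => if (I A - E I) / √v ≤ z then 1 else 0) := by
    rw [← hint, ← integral_indicator_one MeasurableSet.of_discrete]
    congr 1
    funext A
    simp only [Set.indicator, Set.mem_ofPred_eq, normalized, hvar, hint, Pi.one_apply]
  have hstein : E (fun A => if (I A - E I) / √v ≤ z then 1 else 0) - gaussCDF z
      = E (fun A => steinDeriv z ((I A - E I) / √v)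
        - (I A - E I) / √v * stein z ((I A - E I) / √v)) := by
    rw [← hE.map_const (gaussCDF z), ← map_fun_sub]
    congr 1; funext A; simp only [steinDeriv]; ring
  rw [hQ, hP, hstein]
  have hmain := hE.abs_map_stein_le (F := I) (σ := √v)
    (abs_discDeriv_numIsolatedFaces_le hκ) (abs_discDeriv_discDeriv_numIsolatedFaces_le hκ)
    (fun u => by
      simp_rw [commonFaces_comm κ u]
      exact sum_faceProb_mul_commonFaces_le p u)
    (sum_faceProb_mul_commonFaces_sq_le p) (by positivity) (by positivity)
    (Real.sqrt_pos.2 hv0) (Real.sq_sqrt hv0.le).symm (abs_steinDeriv_le z)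
    (abs_steinMajorant_le z) (abs_stein_sub_le z)
  refine hmain.trans ?_
  rw [Real.sq_sqrt hv0.le, sum_faceProb]
  have hs := Real.sqrt_pos.2 hS
  calc _ ≤ 2 * √(n.choose (κ + 1) * (p : ℝ)) * K
        / (n.choose (κ + 1) * p * (1 - (p : ℝ)) ^ (2 * n + 1)) := by
        gcongr
    _ = _ := by
        rw [div_eq_div_iff (by positivity) (by positivity)]
        have := Real.mul_self_sqrt hS.le
        linear_combination 2 * K * (1 - (p : ℝ)) ^ (2 * n + 1) * this

end

lemma exp_neg_le_one_sub_pow {x : ℝ} (h0 : 0 ≤ x) (h1 : x ≤ 1 / 2) {n : ℕ} (hn : 1 ≤ n) :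
    Real.exp (-(6 * (n * x))) ≤ (1 - x) ^ (2 * n + 1) := by
  -- For `0 ≤ x ≤ 1/2`, `(1 + 2x)(1 - x) ≥ 1`. The constant 6 then comes from `2 * (2n + 1) ≤ 6n`.
  have h2 : Real.exp (-(2 * x)) ≤ 1 - x := by
    rw [Real.exp_neg, inv_le_comm₀ (Real.exp_pos _) (by linarith)]
    refine le_trans ?_ (Real.add_one_le_exp _)
    rw [inv_le_iff_one_le_mul₀ (by linarith)]
    nlinarith
  have hn' : (1 : ℝ) ≤ n := by exact_mod_cast hn
  calc _ ≤ Real.exp ((2 * n + 1 : ℕ) * -(2 * x)) := by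
        rw [Real.exp_le_exp]; push_cast; nlinarith
    _ = Real.exp (-(2 * x)) ^ (2 * n + 1) := Real.exp_nat_mul _ _
    _ ≤ _ := pow_le_pow_left₀ (Real.exp_pos _).le h2 _

lemma pow_le_choose_of_two_mul_le {κ n : ℕ} (h : 2 * κ ≤ n) :
    (n : ℝ) ^ (κ + 1) / (2 ^ (κ + 1) * (κ + 1).factorial) ≤ n.choose (κ + 1) := by
  have h1 := Nat.pow_le_choose (α := ℝ) (κ + 1) n
  have h3 : (n : ℝ) / 2 ≤ ((n + 1 - (κ + 1) : ℕ) : ℝ) := by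
    rw [div_le_iff₀ two_pos]
    exact_mod_cast (by omega : n ≤ (n + 1 - (κ + 1)) * 2)
  have h4 : ((n : ℝ) / 2) ^ (κ + 1) ≤ ((n + 1 - (κ + 1) : ℕ) : ℝ) ^ (κ + 1) :=
    pow_le_pow_left₀ (by positivity) h3 _
  rw [div_pow] at h4
  rw [← div_div]
  exact le_trans (by gcongr) h1

end RandomComplex

open RandomComplex in
theorem theorem1p4 (κ : ℕ) (hκ : 1 ≤ κ) (p : ℕ → unitInterval)
    (hp : (fun n : ℕ => (n : ℝ) * (p n : ℝ)) =O[atTop] (fun _ => (1 : ℝ)))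
    (hp' : Tendsto (fun n : ℕ => (n : ℝ) ^ (κ + 1) * (p n : ℝ)) atTop atTop)
    {Ω' : Type*} [MeasurableSpace Ω'] (Q : Measure Ω') [IsProbabilityMeasure Q]
    (N : Ω' → ℝ) (hN : HasLaw N (gaussianReal 0 1) Q) :
    (fun n : ℕ =>
      kolmogorovDist
        (normalized (RandomComplex.numIsolatedFaces κ n) (RandomComplex.faceMeasure κ n (p n)))
        (RandomComplex.faceMeasure κ n (p n)) N Q)
      =O[atTop]
        (fun n : ℕ => (n : ℝ) ^ (-((κ : ℝ) + 1) / 2) * (p n : ℝ) ^ (-(1 / 2) : ℝ)) := by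
  obtain ⟨M, hM⟩ := hp.bound
  set c : ℝ := (2 ^ (κ + 1) * (κ + 1).factorial)⁻¹ with hc
  have hc0 : 0 < c := by positivity
  set K : ℝ := 2 * (2 * (κ + 1) * ((κ + 1) * M)
    + (κ + 1) * √((κ + 1) ^ 2 + (κ + 1) * ((κ + 1) * M))) with hK
  refine IsBigO.of_bound (K / (√c * Real.exp (-(6 * M)))) ?_
  filter_upwards [hM, hp'.eventually_gt_atTop 0, eventually_ge_atTop (2 * κ),
    eventually_ge_atTop 1, tendsto_natCast_atTop_atTop.eventually_ge_atTop (2 * M)]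
    with n hnp hpos hn2 hn1 hnM
  have hp0 : (0 : ℝ) ≤ p n := (p n).2.1
  have hn0 : (0 : ℝ) < n := by exact_mod_cast hn1
  have hpn : (0 : ℝ) < p n := pos_of_mul_pos_right hpos (by positivity)
  rw [norm_one, mul_one, Real.norm_eq_abs, abs_of_nonneg (by positivity)] at hnp
  have hM0 : 0 ≤ M := le_trans (by positivity) hnp
  -- From `n p ≤ M` and `2M ≤ n`; this also keeps `p` away from 1, where the variance bound
  -- degenerates.
  have hhalf : (p n : ℝ) ≤ 1 / 2 := by nlinarith
  have hchoose := pow_le_choose_of_two_mul_le hn2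
  have hS : c * ((n : ℝ) ^ (κ + 1) * p n) ≤ n.choose (κ + 1) * p n := by
    calc _ = (n : ℝ) ^ (κ + 1) / (2 ^ (κ + 1) * (κ + 1).factorial) * p n := by
          rw [hc]; ring
      _ ≤ _ := by gcongr
  have hS0 : 0 < c * ((n : ℝ) ^ (κ + 1) * p n) := by positivity
  have hrate : (n : ℝ) ^ (-((κ : ℝ) + 1) / 2) * (p n : ℝ) ^ (-(1 / 2) : ℝ)
      = (√((n : ℝ) ^ (κ + 1) * p n))⁻¹ := by
    rw [Real.sqrt_eq_rpow, Real.mul_rpow (by positivity) hp0, mul_inv, Real.rpow_neg hp0,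
      ← Real.rpow_natCast, ← Real.rpow_mul hn0.le, ← Real.rpow_neg hn0.le]
    congr 2
    push_cast; ring
  have hexp : Real.exp (-(6 * M)) ≤ (1 - (p n : ℝ)) ^ (2 * n + 1) := by
    refine le_trans ?_ (exp_neg_le_one_sub_pow hp0 hhalf hn1)
    gcongr
  have hbound := kolmogorovDist_numIsolatedFaces_le (n := n) (p n) hκ (by linarith)
    (hS0.trans_le hS) hN
  have hnonneg : 0 ≤ kolmogorovDist (normalized (numIsolatedFaces κ n) (faceMeasure κ n (p n)))
      (faceMeasure κ n (p n)) N Q := Real.iSup_nonneg fun z => abs_nonneg _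
  rw [hrate, Real.norm_eq_abs, Real.norm_eq_abs, abs_of_nonneg hnonneg,
    abs_of_nonneg (by positivity)]
  refine hbound.trans ?_
  calc _ ≤ K / (√(c * ((n : ℝ) ^ (κ + 1) * p n)) * Real.exp (-(6 * M))) := by
        rw [hK]; gcongr
    _ = _ := by
        rw [Real.sqrt_mul hc0.le]
        field_simp
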